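/- For integers $d,n\ge 1$, let $\mathbb T^d_n=(\mathbb R/n^{1/d}\mathbb Z)^d$ be the flat $d$-dimensional torus of volume $n$, with the metric inherited from the Euclidean metric of $\mathbb R^d$. The $d$-NN tree $G_n$ is the random tree on the vertex set $\{0,1,\dots,n-1\}$ defined as follows: the vertices are embedded one after another, in the order $0,1,\dots,n-1$, at independent uniformly distributed positions in $\mathbb T^d_n$, and each vertex $i\ge 1$ is joined by an edge on arrival to the nearest of the vertices $0,\dots,i-1$ (ties, which have probability zero, are broken in favour of the smallest label). Let $\mathcal{LT}^0_n$ be the set of labelled trees on the vertex set $\{0,1,\dots,n-1\}$, rooted at $0$. For $L>0$, a function $g:\mathcal{LT}^0_n\to\mathbb R$ is called $L$-Lipschitz if $|g(T_1)-g(T_2)|\le L\,|E(T_1)\,\Delta\,E(T_2)|$ for all $T_1,T_2\in\mathcal{LT}^0_n$, where $E(T)$ is the edge set of $T$ and $\Delta$ is the symmetric difference. **Theorem.** For every integer $d\ge 1$ there is a constant $C_d>0$, depending only on $d$, such that the following holds for every integer $n\ge 1$, all reals $\alpha\ge 0$ and $L>0$, and every $L$-Lipschitz function $g:\mathcal{LT}^0_n\to\mathbb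 R$ with values in $[0,n^{\alpha}]$. Set $\mu=\mathbb E\,g(G_n)$. Then for every real $\phi=\phi(n)>0$ with $\phi\ge C_d\log n$ and every real $t\ge 0$, $$\mathbb P\big(|g(G_n)-\mu|\ge t\big)\le 2\exp\left(-\frac{t^2}{64\,n\,L^2\,\phi^2}\right)+\exp\left(-\frac{\phi\log\phi}{10}\right).$$ -/

import Mathlib

open MeasureTheory ProbabilityTheory

namespace OnlineNN

/-- Side length `n ^ (1/d)` of the flat `d`-dimensional torus of volume `n`. -/
noncomputable def side (d n : ℕ) : ℝ := (n : ℝ) ^ (1 / (d : ℝ))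

instance fact_side_pos (d n : ℕ) [NeZero n] : Fact (0 < side d n) :=
  ⟨Real.rpow_pos_of_pos (Nat.cast_pos.mpr (Nat.pos_of_ne_zero (NeZero.ne n))) _⟩

/-- The flat torus `(ℝ / n^(1/d) ℤ)^d` of dimension `d` and volume `n`. Its σ-algebra and its
volume are the product ones (for Lebesgue measure on each circle). -/
abbrev Torus (d n : ℕ) : Type := Fin d → AddCircle (side d n)

/-- The metric inherited from the Euclidean metric of `ℝ^d`. (The `dist` that a function type
carries in Mathlib is the sup metric and is not used.) -/
noncomputable def torusDist {d n : ℕ} (x y : Torus d n) : ℝ :=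
  √(∑ k, dist (x k) (y k) ^ 2)

/-- `j` is the vertex to which vertex `i` connects on arrival, when the vertices `0, 1, …, n-1`
have positions `x`: it arrived before `i` and is nearest to `i` among the vertices with this
property. Ties, which have probability zero, are broken in favour of the smallest label. -/
def IsParent {d n : ℕ} (x : Fin n → Torus d n) (i j : Fin n) : Prop :=
  j < i ∧ (∀ k, k < i → torusDist (x i) (x j) ≤ torusDist (x i) (x k)) ∧
    ∀ k, k < j → torusDist (x i) (x j) < torusDist (x i) (x k)

/-- The graph produced by the online nearest neighbor process from the positions `x`. -/
def nnGraph {d n : ℕ} (x : Fin n → Torus d n) : SimpleGraph (Fin n) where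
  Adj i j := IsParent x i j ∨ IsParent x j i
  symm := ⟨fun _ _ h => h.symm⟩
  loopless := ⟨fun _ h => h.elim (fun h => lt_irrefl _ h.1) (fun h => lt_irrefl _ h.1)⟩

/-- Labelled trees with vertex set `{0, …, n-1}`. The root is always the vertex `0`, so it is
not recorded. -/
abbrev LabelledTree (n : ℕ) : Type := {T : SimpleGraph (Fin n) // T.IsTree}

/-- The number `|E(T₁) Δ E(T₂)|`. -/
noncomputable def edgeDist {n : ℕ} (T₁ T₂ : LabelledTree n) : ℕ :=
  (symmDiff T₁.1.edgeSet T₂.1.edgeSet).ncard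

/-- `g` is `L`-Lipschitz for the edge symmetric-difference metric. -/
def IsLipschitz {n : ℕ} (L : ℝ) (g : LabelledTree n → ℝ) : Prop :=
  ∀ T₁ T₂ : LabelledTree n, |g T₁ - g T₂| ≤ L * edgeDist T₁ T₂

theorem IsParent.unique {d n : ℕ} {x : Fin n → Torus d n} {i j k : Fin n}
    (hj : IsParent x i j) (hk : IsParent x i k) : j = k := by
  rcases lt_trichotomy j k with h | h | h
  · exact absurd (hj.2.1 k hk.1) (not_le.mpr (hk.2.2 j h))
  · exact h
  · exact absurd (hk.2.1 j hj.1) (not_le.mpr (hj.2.2 k h))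

theorem exists_isParent {d n : ℕ} [NeZero n] (x : Fin n → Torus d n) {i : Fin n} (hi : i ≠ 0) :
    ∃ j, IsParent x i j := by
  classical
  obtain ⟨m, hm, hmin⟩ := Finset.exists_min_image (Finset.Iio i)
    (fun j => torusDist (x i) (x j)) ⟨0, Finset.mem_Iio.mpr (Fin.pos_iff_ne_zero.mpr hi)⟩
  set S := (Finset.Iio i).filter fun j => torusDist (x i) (x j) ≤ torusDist (x i) (x m) with hS
  obtain ⟨j, hj, hjmin⟩ := Finset.exists_min_image S id
    ⟨m, Finset.mem_filter.mpr ⟨hm, le_rfl⟩⟩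
  obtain ⟨hji, hjm⟩ := Finset.mem_filter.mp hj
  rw [Finset.mem_Iio] at hji
  refine ⟨j, hji, fun k hk => hjm.trans (hmin k (Finset.mem_Iio.mpr hk)), fun k hk => ?_⟩
  by_contra hlt
  have hkS : k ∈ S := Finset.mem_filter.mpr
    ⟨Finset.mem_Iio.mpr (hk.trans hji), (not_lt.mp hlt).trans hjm⟩
  exact absurd hk (not_lt.mpr (hjmin k hkS))

theorem nnGraph_connected {d n : ℕ} [NeZero n] (x : Fin n → Torus d n) :
    (nnGraph x).Connected := by
  have key : ∀ m : ℕ, ∀ i : Fin n, (i : ℕ) = m → (nnGraph x).Reachable i 0 := by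
    intro m
    induction m using Nat.strong_induction_on with
    | _ m ih =>
      intro i him
      by_cases hi : i = 0
      · rw [hi]
      · obtain ⟨j, hj⟩ := exists_isParent x hi
        have hadj : (nnGraph x).Adj i j := Or.inl hj
        have hlt : (j : ℕ) < m := him ▸ hj.1
        exact hadj.reachable.trans (ih j hlt j rfl)
  exact { preconnected := fun i j => (key i i rfl).trans (key j j rfl).symm, nonempty := ⟨0⟩ }

theorem nnGraph_isTree {d n : ℕ} [NeZero n] (x : Fin n → Torus d n) : (nnGraph x).IsTree := by
  classical
  rw [SimpleGraph.isTree_iff_connected_and_card]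
  refine ⟨nnGraph_connected x, le_antisymm ?_
    (nnGraph_connected x).card_vert_le_card_edgeSet_add_one⟩
  choose! p hp using fun (i : Fin n) (hi : i ≠ 0) => exists_isParent x hi
  have hne : ∀ i j, IsParent x i j → i ≠ 0 := fun i j h h0 => by
    rw [h0] at h; exact absurd h.1 (not_lt.mpr (Fin.zero_le j))
  have hsub : (nnGraph x).edgeSet ⊆ (fun i => s(i, p i)) '' {i : Fin n | i ≠ 0} := by
    intro e
    induction e using Sym2.ind with
    | _ i j =>
      rintro (h | h)
      · exact ⟨i, hne i j h, congrArg (fun k => s(i, k)) ((hp i (hne i j h)).unique h)⟩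
      · exact ⟨j, hne j i h, (congrArg (fun k => s(j, k)) ((hp j (hne j i h)).unique h)).trans Sym2.eq_swap⟩
  have h1 := Set.ncard_le_ncard hsub (Set.toFinite _)
  have h2 := h1.trans (Set.ncard_image_le (Set.toFinite _))
  have h3 : {i : Fin n | i ≠ 0}.ncard + 1 = n := by
    have := Set.ncard_add_ncard_compl ({0} : Set (Fin n))
    rw [Set.ncard_singleton, Nat.card_eq_fintype_card, Fintype.card_fin] at this
    exact (add_comm _ _).trans this
  rw [Nat.card_eq_fintype_card (α := Fin n), Fintype.card_fin]
  calc Nat.card (nnGraph x).edgeSet + 1 ≤ {i : Fin n | i ≠ 0}.ncard + 1 :=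
        Nat.add_le_add_right h2 1
    _ = n := h3

/-- The `d`-NN tree on `n` vertices built from the positions `x`, as a labelled tree. -/
def nnTree {d n : ℕ} [NeZero n] (x : Fin n → Torus d n) : LabelledTree n :=
  ⟨nnGraph x, nnGraph_isTree x⟩

end OnlineNN

/-! Reveal the positions one at a time and bound the increments of the Doob martingale of g. Moving
vertex i changes the parent only of i and of vertices that are children of i before or after the
move (`edgeDist_nnTree_le`). A vertex may have many children, but averaging over the later positions
leaves O(log n) of them, whatever the earlier positions are. By a cone argument, a point is nearest
neighbour to at most K = K(d) points of any family (`exists_isNearestBound`). The points arriving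
after i are exchangeable, so vertex j is a child of i with probability at most K / (j - i)
(`measureReal_isParent_splice_le`), and summing over j gives K (1 + log n).

The increments are thus bounded surely by a multiple of L (1 + log n)
(`abs_integral_splice_sub_le`), and the conditional form of McDiarmid's inequality
(`measureReal_abs_sub_integral_ge_le`) gives the Gaussian tail. -/

section Concentration

/-! ### Bounded differences for conditional expectations -/

/-- The configuration that follows `x` before the coordinate `i`, takes the value `a` there, and
follows `y` afterwards. -/
def splice {n : ℕ} {S : Type*} (i : Fin n) (x : Fin n → S) (a : S) (y : Fin n → S) : Fin n → S :=
  fun k => if k < i then x k else if k = i then a else y k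

theorem splice_zero_cons {n : ℕ} {S : Type*} (x : Fin (n + 1) → S) (a s : S) (y : Fin n → S) :
    splice 0 x a (Fin.cons s y) = (Fin.cons a y : Fin (n + 1) → S) := by
  funext k
  refine Fin.cases ?_ (fun j => ?_) k
  · simp [splice]
  · simp [splice, Fin.succ_ne_zero]

theorem splice_succ_cons {n : ℕ} {S : Type*} (i : Fin n) (x : Fin n → S) (a s r : S)
    (y : Fin n → S) :
    splice i.succ (Fin.cons s x) a (Fin.cons r y) =
      (Fin.cons s (splice i x a y) : Fin (n + 1) → S) := by
  funext k
  refine Fin.cases ?_ (fun j => ?_) k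
  · simp [splice]
  · simp [splice]

theorem measurable_splice {n : ℕ} {S : Type*} [MeasurableSpace S] (i : Fin n) (x : Fin n → S)
    (a : S) : Measurable (splice i x a) := by
  refine measurable_pi_lambda _ fun k => ?_
  unfold splice
  split_ifs
  · exact measurable_const
  · exact measurable_const
  · exact measurable_pi_apply k

variable {S : Type*} [MeasurableSpace S]

theorem measurePreserving_cons (μ : Measure S) [SigmaFinite μ] (n : ℕ) :
    MeasurePreserving (fun p : S × (Fin n → S) => (Fin.cons p.1 p.2 : Fin (n + 1) → S))
      (μ.prod (Measure.pi fun _ => μ)) (Measure.pi fun _ => μ) := by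
  have h := (measurePreserving_piFinSuccAbove (fun _ : Fin (n + 1) => μ) 0).symm
  convert h using 2
  funext p
  simp [MeasurableEquiv.piFinSuccAbove, Fin.insertNthEquiv]

theorem integrable_of_abs_le {T : Type*} [MeasurableSpace T] {ν : Measure T} [IsFiniteMeasure ν]
    {f : T → ℝ} (hf : Measurable f) {B : ℝ} (hB : ∀ x, |f x| ≤ B) : Integrable f ν :=
  Integrable.of_bound hf.aestronglyMeasurable B (Filter.Eventually.of_forall hB)

theorem integral_pi_eq_integral_cons (μ : Measure S) [IsProbabilityMeasure μ] {n : ℕ}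
    {f : (Fin (n + 1) → S) → ℝ} (hf : Measurable f) {B : ℝ} (hB : ∀ x, |f x| ≤ B) :
    ∫ z, f z ∂Measure.pi (fun _ => μ) =
      ∫ s, ∫ y, f (Fin.cons s y) ∂Measure.pi (fun _ => μ) ∂μ := by
  have h := measurePreserving_cons μ n
  rw [← h.map_eq, integral_map h.measurable.aemeasurable hf.aestronglyMeasurable,
    integral_prod (fun p : S × (Fin n → S) => f (Fin.cons p.1 p.2))
      (integrable_of_abs_le (hf.comp h.measurable) fun p => hB _)]

theorem abs_integral_le_of_abs_le {T : Type*} [MeasurableSpace T] {ν : Measure T}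
    [IsProbabilityMeasure ν] {f : T → ℝ} {B : ℝ} (hB : ∀ x, |f x| ≤ B) : |∫ x, f x ∂ν| ≤ B := by
  simpa using norm_integral_le_of_norm_le_const (μ := ν) (f := f) (Filter.Eventually.of_forall hB)

/-- Hoeffding's lemma: oscillation at most `c` places `h` in an interval of length `c` starting at
its infimum. -/
theorem mgf_sub_integral_le_of_osc (μ : Measure S) [IsProbabilityMeasure μ] {h : S → ℝ}
    (hm : Measurable h) {c : ℝ} (hc : ∀ a b, |h a - h b| ≤ c) (t : ℝ) :
    ∫ s, Real.exp (t * (h s - ∫ r, h r ∂μ)) ∂μ ≤ Real.exp ((c / 2) ^ 2 * t ^ 2 / 2) := by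
  have : Nonempty S := nonempty_of_isProbabilityMeasure μ
  have hbdd : BddBelow (Set.range h) := by
    obtain ⟨s⟩ := this
    refine ⟨h s - c, ?_⟩
    rintro _ ⟨r, rfl⟩
    linarith [(abs_le.mp (hc s r)).2]
  have hIcc : ∀ s, h s ∈ Set.Icc (⨅ r, h r) ((⨅ r, h r) + c) := fun s => by
    refine ⟨ciInf_le hbdd s, ?_⟩
    have : h s - c ≤ ⨅ r, h r := le_ciInf fun r => by linarith [(abs_le.mp (hc s r)).2]
    linarith
  have := (hasSubgaussianMGF_of_mem_Icc hm.aemeasurable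
    (Filter.Eventually.of_forall (p := fun s => h s ∈ _) hIcc) (μ := μ)).mgf_le t
  simpa [mgf, div_pow, sq_abs] using this

/-- **McDiarmid's inequality** in its conditional form: if changing the `i`-th of `n` independent
coordinates changes the conditional expectation given the first `i` coordinates by at most `c`,
then the function is sub-Gaussian about its mean. -/
theorem integral_exp_sub_integral_le (μ : Measure S) [IsProbabilityMeasure μ] {c : ℝ} (t : ℝ)
    {n : ℕ} {f : (Fin n → S) → ℝ} (hf : Measurable f) {B : ℝ} (hB : ∀ x, |f x| ≤ B)
    (hc : ∀ i x a b, |∫ y, f (splice i x a y) ∂Measure.pi (fun _ => μ) -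
      ∫ y, f (splice i x b y) ∂Measure.pi (fun _ => μ)| ≤ c) :
    ∫ z, Real.exp (t * (f z - ∫ y, f y ∂Measure.pi (fun _ => μ))) ∂Measure.pi (fun _ => μ) ≤
      Real.exp (n * (c / 2) ^ 2 * t ^ 2 / 2) := by
  have expBdd : ∀ {m : ℝ} {u : ℝ}, |u| ≤ B → |m| ≤ B →
      |Real.exp (t * (u - m))| ≤ Real.exp (|t| * (B + B)) := by
    intro m u hu hm
    rw [Real.abs_exp, Real.exp_le_exp]
    refine (le_abs_self _).trans ?_
    rw [abs_mul]
    exact mul_le_mul_of_nonneg_left ((abs_sub _ _).trans (add_le_add hu hm)) (abs_nonneg _)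
  induction n with
  | zero =>
    have : ∀ z, f z = f default := fun z => congrArg f (Subsingleton.elim _ _)
    simp [this]
  | succ n ih =>
    have hcons : Measurable fun p : S × (Fin n → S) => f (Fin.cons p.1 p.2) :=
      hf.comp (measurePreserving_cons μ n).measurable
    set h : S → ℝ := fun s => ∫ y, f (Fin.cons s y) ∂Measure.pi (fun _ => μ)
    have hhm : Measurable h := hcons.stronglyMeasurable.integral_prod_right'.measurable
    have hhB : ∀ s, |h s| ≤ B := fun s => abs_integral_le_of_abs_le fun y => hB _
    have hmean : ∫ y, f y ∂Measure.pi (fun _ => μ) = ∫ s, h s ∂μ :=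
      integral_pi_eq_integral_cons μ hf hB
    have hmB : |∫ s, h s ∂μ| ≤ B := abs_integral_le_of_abs_le hhB
    rw [hmean, integral_pi_eq_integral_cons μ (f := fun z => Real.exp (t * (f z - ∫ s, h s ∂μ)))
      (by fun_prop) (fun z => expBdd (hB z) hmB)]
    have hsp : ∀ i x a, ∫ y, f (splice i x a y) ∂Measure.pi (fun _ => μ) =
        ∫ s, ∫ y, f (splice i x a (Fin.cons s y)) ∂Measure.pi (fun _ => μ) ∂μ := fun i x a =>
      integral_pi_eq_integral_cons μ (hf.comp (measurable_splice i x a)) fun _ => hB _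
    -- `hc` integrates over all coordinates, also those that `splice` overwrites. At index 0 the
    -- first coordinate of `y` is overwritten, so the integral over it is that of a constant.
    have hosc : ∀ a b, |h a - h b| ≤ c := fun a b => by
      obtain ⟨s⟩ := nonempty_of_isProbabilityMeasure μ
      have := hc 0 (fun _ => s) a b
      rw [hsp, hsp] at this
      simpa only [splice_zero_cons, integral_const, probReal_univ,
        one_smul] using this
    have hfib : ∀ s, ∫ y, Real.exp (t * (f (Fin.cons s y) - h s)) ∂Measure.pi (fun _ => μ) ≤
        Real.exp (n * (c / 2) ^ 2 * t ^ 2 / 2) := fun s => by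
      refine ih (hcons.comp measurable_prodMk_left) (fun y => hB _) fun i x a b => ?_
      have := hc i.succ (Fin.cons s x) a b
      rw [hsp, hsp] at this
      simpa only [splice_succ_cons, integral_const, probReal_univ,
        one_smul] using this
    -- Tower step: the increment from the first coordinate factors out of the fibre, leaving a
    -- function centred at its own mean `h s`.
    have hsplit : ∀ s, ∫ y, Real.exp (t * (f (Fin.cons s y) - ∫ s, h s ∂μ))
          ∂Measure.pi (fun _ => μ) =
        Real.exp (t * (h s - ∫ s, h s ∂μ)) *
          ∫ y, Real.exp (t * (f (Fin.cons s y) - h s)) ∂Measure.pi (fun _ => μ) := fun s => by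
      rw [← integral_const_mul]
      refine integral_congr_ae (Filter.Eventually.of_forall fun y => ?_)
      simp only [← Real.exp_add]
      congr 1
      ring
    have hint : Integrable (fun s => Real.exp (t * (h s - ∫ s, h s ∂μ))) μ :=
      integrable_of_abs_le (by fun_prop) fun s => expBdd (hhB s) hmB
    calc ∫ s, ∫ y, Real.exp (t * (f (Fin.cons s y) - ∫ s, h s ∂μ)) ∂Measure.pi (fun _ => μ) ∂μ
        ≤ ∫ s, Real.exp (t * (h s - ∫ s, h s ∂μ)) * Real.exp (n * (c / 2) ^ 2 * t ^ 2 / 2) ∂μ := by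
          refine integral_mono_of_nonneg
            (Filter.Eventually.of_forall fun s => integral_nonneg fun y => (Real.exp_pos _).le)
            (hint.mul_const _) (Filter.Eventually.of_forall fun s => ?_)
          simp only [hsplit]
          exact mul_le_mul_of_nonneg_left (hfib s) (Real.exp_pos _).le
      _ ≤ Real.exp ((c / 2) ^ 2 * t ^ 2 / 2) * Real.exp (n * (c / 2) ^ 2 * t ^ 2 / 2) := by
          rw [integral_mul_const]
          exact mul_le_mul_of_nonneg_right (mgf_sub_integral_le_of_osc μ hhm hosc t)
            (Real.exp_pos _).le
      _ = Real.exp ((n + 1 : ℕ) * (c / 2) ^ 2 * t ^ 2 / 2) := by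
          rw [← Real.exp_add]
          congr 1
          push_cast
          ring

theorem measureReal_abs_sub_integral_ge_le (μ : Measure S) [IsProbabilityMeasure μ] {c : ℝ}
    {n : ℕ} {f : (Fin n → S) → ℝ} (hf : Measurable f) {B : ℝ} (hB : ∀ x, |f x| ≤ B)
    (hc : ∀ i x a b, |∫ y, f (splice i x a y) ∂Measure.pi (fun _ => μ) -
      ∫ y, f (splice i x b y) ∂Measure.pi (fun _ => μ)| ≤ c) {t : ℝ} (ht : 0 ≤ t) :
    (Measure.pi fun _ => μ).real {z | t ≤ |f z - ∫ y, f y ∂Measure.pi (fun _ => μ)|} ≤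
      2 * Real.exp (-t ^ 2 / (2 * (n * (c / 2) ^ 2))) := by
  set m := ∫ y, f y ∂Measure.pi (fun _ => μ)
  have hsub : HasSubgaussianMGF (fun z => f z - m) ⟨n * (c / 2) ^ 2, by positivity⟩
      (Measure.pi fun _ => μ) :=
    { integrable_exp_mul := fun s => by
        refine integrable_of_abs_le (B := Real.exp (|s| * (B + |m|))) (by fun_prop) fun z => ?_
        rw [Real.abs_exp, Real.exp_le_exp]
        refine (le_abs_self _).trans ?_
        rw [abs_mul]
        exact mul_le_mul_of_nonneg_left ((abs_sub _ _).trans (add_le_add (hB z) le_rfl))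
          (abs_nonneg _)
      mgf_le := fun s => integral_exp_sub_integral_le μ s hf hB hc }
  have h1 := hsub.measure_ge_le ht
  have h2 := hsub.neg.measure_ge_le ht
  have hle : {z | t ≤ |f z - m|} ⊆ {z | t ≤ f z - m} ∪ {z | t ≤ (-fun z => f z - m) z} :=
    fun z hz => by simpa [le_abs] using hz
  refine (measureReal_mono hle).trans ((measureReal_union_le _ _).trans ?_)
  rw [two_mul]
  exact add_le_add h1 h2

end Concentration

/-! ### Cones and the number of nearest neighbours -/

/-- Cover the unit sphere by finitely many balls of radius 1/2, and let `κ` pick a ball containing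
the direction. Directions in one ball differ by less than 1; shortening `u` to length `‖v‖` and then
turning it costs less than `(‖u‖ - ‖v‖) + ‖v‖`. -/
theorem exists_finset_cone_cover (E : Type*) [NormedAddCommGroup E] [NormedSpace ℝ E]
    [ProperSpace E] :
    ∃ (t : Finset E) (κ : E → E), (∀ u, u ≠ 0 → κ u ∈ t) ∧
      ∀ u v, u ≠ 0 → v ≠ 0 → κ u = κ v → ‖v‖ ≤ ‖u‖ → ‖u - v‖ < ‖u‖ := by
  obtain ⟨t, -, htf, hcov⟩ := (isCompact_sphere (0 : E) 1).finite_cover_balls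
    (e := 1 / 2) (by norm_num)
  have hu : ∀ u : E, ∃ w, u ≠ 0 → w ∈ t ∧ ‖‖u‖⁻¹ • u - w‖ < 1 / 2 := fun u => by
    by_cases h : u = 0
    · exact ⟨0, fun h' => absurd h h'⟩
    · have : ‖u‖⁻¹ • u ∈ Metric.sphere (0 : E) 1 := by simp [norm_smul, h]
      obtain ⟨w, hw, hb⟩ := Set.mem_iUnion₂.mp (hcov this)
      exact ⟨w, fun _ => ⟨hw, by simpa [dist_eq_norm] using hb⟩⟩
  choose κ hκ using hu
  refine ⟨htf.toFinset, κ, fun u h => htf.mem_toFinset.mpr (hκ u h).1, fun u v hu hv he hle => ?_⟩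
  have hd : ‖‖u‖⁻¹ • u - ‖v‖⁻¹ • v‖ < 1 := by
    have h1 := (hκ u hu).2
    have h2 := (hκ v hv).2
    rw [← he, norm_sub_rev] at h2
    have := norm_sub_le_norm_sub_add_norm_sub (‖u‖⁻¹ • u) (κ u) (‖v‖⁻¹ • v)
    linarith
  have hv' : 0 < ‖v‖ := norm_pos_iff.mpr hv
  have hu' : 0 < ‖u‖ := norm_pos_iff.mpr hu
  have hdec : u - v = (‖u‖ - ‖v‖) • (‖u‖⁻¹ • u) + ‖v‖ • (‖u‖⁻¹ • u - ‖v‖⁻¹ • v) := by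
    rw [sub_smul, smul_sub, smul_inv_smul₀ hu'.ne', smul_inv_smul₀ hv'.ne']
    abel
  calc ‖u - v‖ ≤ ‖(‖u‖ - ‖v‖) • (‖u‖⁻¹ • u)‖ + ‖‖v‖ • (‖u‖⁻¹ • u - ‖v‖⁻¹ • v)‖ := by
        conv_lhs => rw [hdec]
        exact norm_add_le _ _
    _ = (‖u‖ - ‖v‖) + ‖v‖ * ‖‖u‖⁻¹ • u - ‖v‖⁻¹ • v‖ := by
        rw [norm_smul, norm_smul, norm_smul, norm_inv, norm_norm, norm_norm,
          inv_mul_cancel₀ hu'.ne', mul_one, Real.norm_of_nonneg (sub_nonneg.mpr hle)]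
    _ < (‖u‖ - ‖v‖) + ‖v‖ * 1 := by gcongr
    _ = ‖u‖ := by ring

theorem AddCircle.exists_abs_eq_norm (p : ℝ) (z : AddCircle p) :
    ∃ r : ℝ, (r : AddCircle p) = z ∧ |r| = ‖z‖ := by
  induction z using QuotientAddGroup.induction_on with
  | H x =>
    refine ⟨x - round (p⁻¹ * x) * p, ?_, (AddCircle.norm_eq p).symm⟩
    have : ((round (p⁻¹ * x) * p : ℝ) : AddCircle p) = 0 := by
      rw [AddCircle.coe_eq_zero_iff]
      exact ⟨round (p⁻¹ * x), by simp⟩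
    rw [AddCircle.coe_sub, this, sub_zero]

namespace OnlineNN

theorem exists_euclidean_lift {d n : ℕ} (a : Torus d n) (x : Torus d n) :
    ∃ u : EuclideanSpace ℝ (Fin d), (∀ k, ((u k : ℝ) : AddCircle (side d n)) = x k - a k) ∧
      ‖u‖ = torusDist x a := by
  choose r hr hn using fun k => AddCircle.exists_abs_eq_norm (side d n) (x k - a k)
  refine ⟨WithLp.toLp 2 r, hr, ?_⟩
  simp [EuclideanSpace.norm_eq, torusDist, hn, dist_eq_norm]

/-- Lifts around `a` can preserve distances to `a`, while other distances can only shrink on the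
torus. This one-sided bound is all the cone argument needs. -/
theorem torusDist_le_norm_sub {d n : ℕ} {a x y : Torus d n} {u v : EuclideanSpace ℝ (Fin d)}
    (hu : ∀ k, ((u k : ℝ) : AddCircle (side d n)) = x k - a k)
    (hv : ∀ k, ((v k : ℝ) : AddCircle (side d n)) = y k - a k) :
    torusDist x y ≤ ‖u - v‖ := by
  rw [EuclideanSpace.norm_eq, torusDist]
  refine Real.sqrt_le_sqrt (Finset.sum_le_sum fun k _ => ?_)
  have : x k - y k = ((u k - v k : ℝ) : AddCircle (side d n)) := by
    rw [AddCircle.coe_sub, hu, hv]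
    abel
  rw [dist_eq_norm, this]
  exact pow_le_pow_left₀ (norm_nonneg _) QuotientAddGroup.norm_mk_le_norm 2

/-- A point of the `d`-dimensional torus is the nearest neighbour of at most `K` points of any
family of points different from it. -/
def IsNearestBound (d K : ℕ) : Prop :=
  ∀ (n : ℕ) (a : Torus d n) {ι : Type} (s : Finset ι) (y : ι → Torus d n),
    (∀ l ∈ s, y l ≠ a) →
    (∀ l ∈ s, ∀ k ∈ s, k ≠ l → torusDist (y l) a ≤ torusDist (y l) (y k)) → s.card ≤ K

/-- Of two points in one cone around `a`, the farther is strictly closer to the other point than to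
`a`; hence each cone holds at most one point of the family. -/
theorem exists_isNearestBound (d : ℕ) : ∃ K : ℕ, IsNearestBound d K := by
  classical
  obtain ⟨t, κ, hκt, hκ⟩ := exists_finset_cone_cover (EuclideanSpace ℝ (Fin d))
  refine ⟨t.card, fun n a ι s y hne hnear => ?_⟩
  choose u hu hun using fun l => exists_euclidean_lift a (y l)
  have hu0 : ∀ l ∈ s, u l ≠ 0 := fun l hl h0 => hne l hl <| funext fun k => by
    have := hu l k
    rw [h0] at this
    exact (sub_eq_zero.mp (by simpa using this.symm))
  have hfar : ∀ l ∈ s, ∀ k ∈ s, k ≠ l → κ (u l) = κ (u k) → ‖u k‖ ≤ ‖u l‖ → False :=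
    fun l hl k hk hkl he hle => by
      have h1 := hκ (u l) (u k) (hu0 l hl) (hu0 k hk) he hle
      have h2 := hnear l hl k hk hkl
      have h3 := torusDist_le_norm_sub (hu l) (hu k)
      rw [hun] at h1
      linarith
  refine Finset.card_le_card_of_injOn (fun l => κ (u l)) (fun l hl => hκt _ (hu0 l hl)) ?_
  intro l hl k hk he
  by_contra hlk
  rcases le_total ‖u k‖ ‖u l‖ with h | h
  · exact hfar l hl k hk (Ne.symm hlk) he h
  · exact hfar k hk l hl hlk he.symm h

end OnlineNN

/-! ### Measurability, and the effect of moving one vertex -/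

namespace OnlineNN

theorem measurable_torusDist {d n : ℕ} [NeZero n] {T : Type*} [MeasurableSpace T]
    {f g : T → Torus d n} (hf : Measurable f) (hg : Measurable g) :
    Measurable fun t => torusDist (f t) (g t) := by
  unfold torusDist
  refine Measurable.sqrt (Finset.measurable_sum _ fun k _ => Measurable.pow_const ?_ 2)
  exact ((measurable_pi_apply k).comp hf).dist ((measurable_pi_apply k).comp hg)

theorem measurableSet_isParent {d n : ℕ} [NeZero n] (i j : Fin n) :
    MeasurableSet {x : Fin n → Torus d n | IsParent x i j} := by
  have h : ∀ k l : Fin n, Measurable fun x : Fin n → Torus d n => torusDist (x k) (x l) :=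
    fun k l => measurable_torusDist (measurable_pi_apply k) (measurable_pi_apply l)
  have hle : ∀ k, Measurable fun x : Fin n → Torus d n =>
      torusDist (x i) (x j) ≤ torusDist (x i) (x k) := fun k =>
    measurableSet_setOfPred.mp (measurableSet_le (h i j) (h i k))
  have hlt : ∀ k, Measurable fun x : Fin n → Torus d n =>
      torusDist (x i) (x j) < torusDist (x i) (x k) := fun k =>
    measurableSet_setOfPred.mp (measurableSet_lt (h i j) (h i k))
  refine measurableSet_setOfPred.mpr (measurable_const.and (Measurable.and ?_ ?_))
  · exact .forall fun k => measurable_const.imp (hle k)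
  · exact .forall fun k => measurable_const.imp (hlt k)

theorem measurable_comp_nnTree {d n : ℕ} [NeZero n] (g : LabelledTree n → ℝ) :
    Measurable fun x : Fin n → Torus d n => g (nnTree x) := by
  let _ : MeasurableSpace (LabelledTree n) := ⊤
  have hT : Measurable (nnTree : (Fin n → Torus d n) → LabelledTree n) := by
    refine measurable_to_countable' fun T => ?_
    have : nnTree ⁻¹' {T} = ⋂ i, ⋂ j, {x : Fin n → Torus d n |
        (IsParent x i j ∨ IsParent x j i) ↔ T.1.Adj i j} := by
      ext x
      simp only [Set.mem_preimage, Set.mem_singleton_iff, Subtype.ext_iff, SimpleGraph.ext_iff,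
        funext_iff, Set.mem_iInter, Set.mem_ofPred_eq, eq_iff_iff]
      rfl
    rw [this]
    refine .iInter fun i => .iInter fun j => ?_
    have hor : MeasurableSet {x : Fin n → Torus d n | IsParent x i j ∨ IsParent x j i} :=
      (measurableSet_isParent i j).union (measurableSet_isParent j i)
    exact measurableSet_setOfPred.mpr ((measurableSet_setOfPred.mp hor).iff measurable_const)
  exact measurable_from_top.comp hT

/-- Both parents of `j` differ from `i`, so each competes against the other at unchanged positions;
the tie-breaking rule forces them to coincide. -/
theorem IsParent.of_eq_off {d n : ℕ} [NeZero n] {x x' : Fin n → Torus d n} {i j k : Fin n}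
    (hx : ∀ l, l ≠ i → x l = x' l) (hj : j ≠ i) (hi : ¬IsParent x j i) (hi' : ¬IsParent x' j i)
    (h : IsParent x j k) : IsParent x' j k := by
  obtain ⟨k', hk'⟩ := exists_isParent x' (i := j) fun h0 => by
    rw [h0] at h; exact absurd h.1 (not_lt.mpr (Fin.zero_le k))
  have hki : k ≠ i := fun h0 => hi (h0 ▸ h)
  have hki' : k' ≠ i := fun h0 => hi' (h0 ▸ hk')
  rcases lt_trichotomy k k' with hlt | heq | hlt
  · have h1 := hk'.2.2 k hlt
    have h2 := h.2.1 k' hk'.1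
    rw [hx j hj, hx k hki, hx k' hki'] at h2
    exact absurd h1 (not_lt.mpr h2)
  · exact heq ▸ hk'
  · have h1 := h.2.2 k' hlt
    have h2 := hk'.2.1 k h.1
    rw [← hx j hj, ← hx k hki, ← hx k' hki'] at h2
    exact absurd h1 (not_lt.mpr h2)

open Classical in
/-- The number of children of the vertex `i`. -/
noncomputable def childCount {d n : ℕ} (x : Fin n → Torus d n) (i : Fin n) : ℕ :=
  (Finset.univ.filter fun j => IsParent x j i).card

theorem edgeDist_nnTree_le {d n : ℕ} [NeZero n] {x x' : Fin n → Torus d n} {i : Fin n}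
    (hx : ∀ l, l ≠ i → x l = x' l) :
    edgeDist (nnTree x) (nnTree x') ≤ 2 * (1 + childCount x i + childCount x' i) := by
  classical
  -- The vertices whose parent may change. Each accounts for at most one edge in either one-sided
  -- difference, whence the factor 2.
  set D : Finset (Fin n) := ({i} ∪ Finset.univ.filter fun j => IsParent x j i) ∪
    Finset.univ.filter fun j => IsParent x' j i with hD
  have hDcard : D.card ≤ 1 + childCount x i + childCount x' i := by
    refine (Finset.card_union_le _ _).trans (add_le_add ((Finset.card_union_le _ _).trans ?_) ?_)
    · rw [Finset.card_singleton, childCount]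
    · rw [childCount]
  choose! p hp using fun (j : Fin n) (hj : j ≠ 0) => exists_isParent x hj
  choose! p' hp' using fun (j : Fin n) (hj : j ≠ 0) => exists_isParent x' hj
  have key : ∀ {z z' : Fin n → Torus d n} {q : Fin n → Fin n},
      (∀ j, j ≠ 0 → IsParent z j (q j)) →
      (∀ j k, j ∉ D → IsParent z j k → IsParent z' j k) →
      (nnGraph z).edgeSet \ (nnGraph z').edgeSet ⊆ ↑(D.image fun j => s(j, q j)) := by
    intro z z' q hq himp e
    have hmem : ∀ j k, IsParent z j k → ¬IsParent z' j k →
        s(j, k) ∈ D.image fun j => s(j, q j) := fun j k h h' => by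
      have hj0 : j ≠ 0 := fun h0 => by
        rw [h0] at h; exact absurd h.1 (not_lt.mpr (Fin.zero_le k))
      refine Finset.mem_image.mpr ⟨j, ?_, by rw [(hq j hj0).unique h]⟩
      by_contra hjD
      exact h' (himp j k hjD h)
    induction e using Sym2.ind with
    | _ j k =>
      rintro ⟨h | h, hn⟩
      · exact hmem j k h fun h' => hn (Or.inl h')
      · rw [Sym2.eq_swap]
        exact hmem k j h fun h' => hn (Or.inr h')
  have hnot : ∀ j, j ∉ D → j ≠ i ∧ ¬IsParent x j i ∧ ¬IsParent x' j i := fun j hj => by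
    simpa [hD, not_or, and_assoc] using hj
  have h1 := key (z := x) (z' := x') hp fun j k hj h =>
    h.of_eq_off hx (hnot j hj).1 (hnot j hj).2.1 (hnot j hj).2.2
  have h2 := key (z := x') (z' := x) hp' fun j k hj h =>
    h.of_eq_off (fun l hl => (hx l hl).symm) (hnot j hj).1 (hnot j hj).2.2 (hnot j hj).2.1
  have h3 := Set.ncard_le_ncard (Set.union_subset_union h1 h2) (Set.toFinite _)
  calc edgeDist (nnTree x) (nnTree x') ≤ _ := h3
    _ ≤ _ := Set.ncard_union_le _ _
    _ ≤ D.card + D.card := by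
        rw [Set.ncard_coe_finset, Set.ncard_coe_finset]
        exact add_le_add Finset.card_image_le Finset.card_image_le
    _ ≤ _ := by omega

end OnlineNN

/-! ### Expected number of children -/

theorem measurePreserving_comp_perm {ι S : Type*} [Fintype ι] [MeasurableSpace S] (μ : Measure S)
    [SigmaFinite μ] (e : Equiv.Perm ι) :
    MeasurePreserving (fun y : ι → S => fun k => y (e k)) (Measure.pi fun _ => μ)
      (Measure.pi fun _ => μ) := by
  have h := measurePreserving_piCongrLeft (fun _ : ι => μ) e.symm
  convert h using 1
  funext y k
  have := Equiv.piCongrLeft_apply_apply (fun _ : ι => S) e.symm y (e k)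
  rw [Equiv.symm_apply_apply] at this
  exact this.symm

namespace OnlineNN

/-- The configurations in which no point with index in `s` other than `y l` is closer to `y l`
than `a`, and `y l ≠ a`. -/
def nearestSet {d n m : ℕ} (a : Torus d n) (s : Finset (Fin m)) (l : Fin m) :
    Set (Fin m → Torus d n) :=
  {y | y l ≠ a ∧ ∀ k ∈ s, k ≠ l → torusDist (y l) a ≤ torusDist (y l) (y k)}

theorem measurableSet_nearestSet {d n m : ℕ} [NeZero n] (a : Torus d n) (s : Finset (Fin m))
    (l : Fin m) : MeasurableSet (nearestSet a s l) := by
  have hle : ∀ k, Measurable fun y : Fin m → Torus d n =>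
      torusDist (y l) a ≤ torusDist (y l) (y k) := fun k =>
    measurableSet_setOfPred.mp (measurableSet_le
      (measurable_torusDist (measurable_pi_apply l) measurable_const)
      (measurable_torusDist (measurable_pi_apply l) (measurable_pi_apply k)))
  have hne : MeasurableSet {y : Fin m → Torus d n | y l ≠ a} :=
    (measurableSet_singleton a).compl.preimage (measurable_pi_apply l)
  exact measurableSet_setOfPred.mpr ((measurableSet_setOfPred.mp hne).and
    (.forall fun k => measurable_const.imp (measurable_const.imp (hle k))))

/-- By exchangeability the event for `j` is at most as likely as that for any `l ∈ s`, and at most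
`K` of the latter occur at once. -/
theorem card_mul_measureReal_nearestSet_le {d K : ℕ}
    (hK : IsNearestBound d K)
    {n m : ℕ} [NeZero n] (μ : Measure (Torus d n)) [IsProbabilityMeasure μ] (a : Torus d n)
    (s : Finset (Fin m)) (j : Fin m) :
    s.card * (Measure.pi fun _ : Fin m => μ).real (nearestSet a s j) ≤ K := by
  classical
  have hsymm : ∀ l ∈ s, (Measure.pi fun _ : Fin m => μ).real (nearestSet a s j) ≤
      (Measure.pi fun _ : Fin m => μ).real (nearestSet a s l) := fun l hl => by
    have hmp := measurePreserving_comp_perm (ι := Fin m) μ (Equiv.swap l j)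
    rw [← hmp.measureReal_preimage (measurableSet_nearestSet a s j).nullMeasurableSet]
    refine measureReal_mono fun y hy => ?_
    obtain ⟨h1, h2⟩ := hy
    simp only [Equiv.swap_apply_right] at h1 h2
    refine ⟨h1, fun k hk hkl => ?_⟩
    have := h2 (Equiv.swap l j k) ?_ ?_
    · simpa using this
    · by_cases hkj : k = j
      · simpa [hkj] using hl
      · rwa [Equiv.swap_apply_of_ne_of_ne hkl hkj]
    · intro h
      rw [Equiv.swap_apply_eq_iff, Equiv.swap_apply_right] at h
      exact hkl h
  have hint : ∀ l ∈ s, Integrable ((nearestSet a s l).indicator fun _ => (1 : ℝ))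
      (Measure.pi fun _ : Fin m => μ) := fun l _ =>
    (integrable_const _).indicator (measurableSet_nearestSet a s l)
  calc s.card * (Measure.pi fun _ : Fin m => μ).real (nearestSet a s j)
      ≤ ∑ l ∈ s, (Measure.pi fun _ : Fin m => μ).real (nearestSet a s l) := by
        rw [← nsmul_eq_mul]
        exact Finset.card_nsmul_le_sum _ _ _ hsymm
    _ = ∫ y, ∑ l ∈ s, (nearestSet a s l).indicator (fun _ => (1 : ℝ)) y
          ∂Measure.pi fun _ : Fin m => μ := by
        rw [integral_finsetSum _ hint]
        refine Finset.sum_congr rfl fun l _ => ?_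
        rw [integral_indicator_const _ (measurableSet_nearestSet a s l), smul_eq_mul, mul_one]
    _ ≤ ∫ _, (K : ℝ) ∂Measure.pi fun _ : Fin m => μ := by
        refine integral_mono (integrable_finsetSum _ hint) (integrable_const _) fun y => ?_
        simp only [Set.indicator_apply, Finset.sum_boole]
        refine Nat.cast_le.mpr (hK n a _ y (fun l hl => ?_) fun l hl k hk hkl => ?_)
        · exact (Finset.mem_filter.mp hl).2.1
        · exact (Finset.mem_filter.mp hl).2.2 k (Finset.mem_filter.mp hk).1 hkl
    _ = K := by simp

/-- Forgetting the competitors that arrived before `i` enlarges the event and leaves only `a` and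
the j - i exchangeable points of `Finset.Ioc i j`. The absence of atoms disposes of `y j = a`. -/
theorem measureReal_isParent_splice_le {d K : ℕ}
    (hK : IsNearestBound d K)
    {n : ℕ} [NeZero n] (μ : Measure (Torus d n)) [IsProbabilityMeasure μ]
    (hμ : ∀ a, μ {a} = 0) (a : Torus d n) (x : Fin n → Torus d n) {i j : Fin n} (hij : i < j) :
    (Measure.pi fun _ => μ).real {y | IsParent (splice i x a y) j i} ≤
      K * (((j - i - 1 : ℕ) : ℝ) + 1)⁻¹ := by
  have hsub : {y | IsParent (splice i x a y) j i} ⊆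
      nearestSet a (Finset.Ioc i j) j ∪ Function.eval j ⁻¹' {a} := by
    intro y hy
    by_cases hya : y j = a
    · exact Or.inr hya
    refine Or.inl ⟨hya, fun k hk hkj => ?_⟩
    obtain ⟨hik, hkj'⟩ := Finset.mem_Ioc.mp hk
    have := hy.2.1 k (lt_of_le_of_ne hkj' hkj)
    simpa [splice, hij.not_gt, hij.ne', hik.not_gt, hik.ne'] using this
  have hnull : (Measure.pi fun _ : Fin n => μ).real (Function.eval j ⁻¹' {a}) = 0 := by
    rw [(measurePreserving_eval (fun _ : Fin n => μ) j).measureReal_preimage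
      (measurableSet_singleton a).nullMeasurableSet, measureReal_def, hμ, ENNReal.toReal_zero]
  have h1 := (measureReal_mono hsub).trans (measureReal_union_le (μ := Measure.pi fun _ => μ) _ _)
  rw [hnull, add_zero] at h1
  have h2 := card_mul_measureReal_nearestSet_le hK μ a (Finset.Ioc i j) j
  have hcard : (((Finset.Ioc i j).card : ℕ) : ℝ) = ((j - i - 1 : ℕ) : ℝ) + 1 := by
    rw [Fin.card_Ioc, ← Nat.cast_succ]
    have : (i : ℕ) < j := hij
    congr 1
    omega
  rw [hcard] at h2
  refine h1.trans ?_
  rw [← div_eq_mul_inv, le_div_iff₀ (by positivity), mul_comm]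
  exact h2

theorem sum_Ioi_inv_le {n : ℕ} (i : Fin n) :
    ∑ j ∈ Finset.Ioi i, (((j - i - 1 : ℕ) : ℝ) + 1)⁻¹ ≤ 1 + Real.log n := by
  have hinj : Set.InjOn (fun j : Fin n => (j - i - 1 : ℕ)) (Finset.Ioi i) := by
    intro j hj k hk h
    have h1 : i < j := Finset.mem_Ioi.mp (Finset.mem_coe.mp hj)
    have h2 : i < k := Finset.mem_Ioi.mp (Finset.mem_coe.mp hk)
    simp only at h
    rw [Fin.lt_def] at h1 h2
    exact Fin.ext (by omega)
  rw [← Finset.sum_image (f := fun m : ℕ => ((m : ℝ) + 1)⁻¹) hinj]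
  refine le_trans (Finset.sum_le_sum_of_subset_of_nonneg (t := Finset.range n) ?_ ?_)
    (le_trans (le_of_eq ?_) (harmonic_le_one_add_log n))
  · intro m hm
    obtain ⟨j, -, rfl⟩ := Finset.mem_image.mp hm
    have := j.2
    exact Finset.mem_range.mpr (by omega)
  · intros
    positivity
  · simp [harmonic]

theorem childCount_splice_eq_sum {d n : ℕ} (a : Torus d n) (x y : Fin n → Torus d n) (i : Fin n) :
    (childCount (splice i x a y) i : ℝ) = ∑ j ∈ Finset.Ioi i,
      {y | IsParent (splice i x a y) j i}.indicator (fun _ => (1 : ℝ)) y := by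
  classical
  simp only [Set.indicator_apply, Finset.sum_boole, childCount, Set.mem_ofPred_eq]
  congr 2
  ext j
  simp only [Finset.mem_filter, Finset.mem_univ, true_and, Finset.mem_Ioi]
  exact ⟨fun h => ⟨h.1, h⟩, fun h => h.2⟩

theorem measurableSet_isParent_splice {d n : ℕ} [NeZero n] (a : Torus d n)
    (x : Fin n → Torus d n) (i j : Fin n) :
    MeasurableSet {y | IsParent (splice i x a y) j i} :=
  measurable_splice i x a (measurableSet_isParent j i)

theorem integrable_childCount_splice {d n : ℕ} [NeZero n] (μ : Measure (Torus d n))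
    [IsProbabilityMeasure μ] (a : Torus d n) (x : Fin n → Torus d n) (i : Fin n) :
    Integrable (fun y => (childCount (splice i x a y) i : ℝ)) (Measure.pi fun _ => μ) := by
  simp only [childCount_splice_eq_sum]
  exact integrable_finsetSum _ fun j _ =>
    (integrable_const _).indicator (measurableSet_isParent_splice a x i j)

theorem integral_childCount_splice_le {d K : ℕ}
    (hK : IsNearestBound d K)
    {n : ℕ} [NeZero n] (μ : Measure (Torus d n)) [IsProbabilityMeasure μ]
    (hμ : ∀ a, μ {a} = 0) (a : Torus d n) (x : Fin n → Torus d n) (i : Fin n) :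
    ∫ y, (childCount (splice i x a y) i : ℝ) ∂Measure.pi (fun _ => μ) ≤
      K * (1 + Real.log n) := by
  simp only [childCount_splice_eq_sum]
  rw [integral_finsetSum _ fun j _ =>
    (integrable_const _).indicator (measurableSet_isParent_splice a x i j)]
  refine le_trans (Finset.sum_le_sum fun j hj => ?_)
    (le_trans (Finset.mul_sum _ _ _).symm.le
      (mul_le_mul_of_nonneg_left (sum_Ioi_inv_le i) (Nat.cast_nonneg K)))
  rw [integral_indicator_const _ (measurableSet_isParent_splice a x i j), smul_eq_mul, mul_one]
  exact measureReal_isParent_splice_le hK μ hμ a x (Finset.mem_Ioi.mp hj)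

/-- Couple the two configurations through the same future `y`: the pointwise bound involves child
counts, which become logarithmic only after integration. -/
theorem abs_integral_splice_sub_le {d K : ℕ}
    (hK : IsNearestBound d K)
    {n : ℕ} [NeZero n] (μ : Measure (Torus d n)) [IsProbabilityMeasure μ]
    (hμ : ∀ a, μ {a} = 0) {L : ℝ} (hL : 0 ≤ L) {g : LabelledTree n → ℝ} (hg : IsLipschitz L g)
    {B : ℝ} (hB : ∀ T, |g T| ≤ B) (i : Fin n) (x : Fin n → Torus d n) (a b : Torus d n) :
    |∫ y, g (nnTree (splice i x a y)) ∂Measure.pi (fun _ => μ) -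
      ∫ y, g (nnTree (splice i x b y)) ∂Measure.pi (fun _ => μ)| ≤
      L * (2 * (1 + 2 * K * (1 + Real.log n))) := by
  have hint : ∀ c, Integrable (fun y => g (nnTree (splice i x c y))) (Measure.pi fun _ => μ) :=
    fun c => integrable_of_abs_le ((measurable_comp_nnTree g).comp (measurable_splice i x c))
      fun y => hB _
  have hcc := fun c => integrable_childCount_splice μ c x i
  have hpt : ∀ y, |g (nnTree (splice i x a y)) - g (nnTree (splice i x b y))| ≤
      L * (2 * (1 + childCount (splice i x a y) i + childCount (splice i x b y) i)) := fun y => by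
    refine (hg _ _).trans (mul_le_mul_of_nonneg_left ?_ hL)
    exact_mod_cast edgeDist_nnTree_le (i := i) fun l hl => by simp [splice, hl]
  rw [← integral_sub (hint a) (hint b)]
  refine abs_integral_le_integral_abs.trans ?_
  have h1 : Integrable (fun y => 1 + (childCount (splice i x a y) i : ℝ))
    (Measure.pi fun _ => μ) := (integrable_const _).add (hcc a)
  have h2 : Integrable (fun y => 1 + (childCount (splice i x a y) i : ℝ) +
    childCount (splice i x b y) i) (Measure.pi fun _ => μ) := h1.add (hcc b)
  refine (integral_mono ((hint a).sub (hint b)).abs ((h2.const_mul 2).const_mul L) hpt).trans ?_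
  rw [integral_const_mul, integral_const_mul, integral_add h1 (hcc b),
    integral_add (integrable_const _) (hcc a), integral_const, probReal_univ, one_smul]
  have ha := integral_childCount_splice_le hK μ hμ a x i
  have hb := integral_childCount_splice_le hK μ hμ b x i
  refine mul_le_mul_of_nonneg_left ?_ hL
  linarith

theorem uniform_torus_singleton {d n : ℕ} (hd : 1 ≤ d) [NeZero n] (a : Torus d n) :
    (cond volume Set.univ : Measure (Torus d n)) {a} = 0 := by
  refine cond_absolutelyContinuous ?_
  have : NullSingletonClass (volume : Measure (AddCircle (side d n))) := ⟨fun z => by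
    rw [← Metric.closedBall_zero, AddCircle.volume_closedBall]
    simp [(fact_side_pos d n).out.le]⟩
  have := Measure.pi_nullSingletonClass (μ := fun _ : Fin d =>
    (volume : Measure (AddCircle (side d n)))) ⟨0, hd⟩
  exact measure_singleton a

end OnlineNN

/-! ### The concentration inequality -/

theorem mainTheorem5 (d : ℕ) (hd : 1 ≤ d) :
    ∃ C : ℝ, 0 < C ∧
      ∀ (n : ℕ) [NeZero n] (α : ℝ) (_ : 0 ≤ α) (L : ℝ) (_ : 0 < L)
        (g : OnlineNN.LabelledTree n → ℝ) (_ : OnlineNN.IsLipschitz L g)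
        (_ : ∀ T, g T ∈ Set.Icc (0 : ℝ) ((n : ℝ) ^ α))
        (φ : ℝ) (_ : 0 < φ) (_ : C * Real.log n ≤ φ) (t : ℝ) (_ : 0 ≤ t)
        (Ω : Type*) [MeasurableSpace Ω] (P : Measure Ω) [IsProbabilityMeasure P]
        (V : Fin n → Ω → OnlineNN.Torus d n) (_ : ∀ i, Measurable (V i))
        (_ : iIndepFun V P) (_ : ∀ i, pdf.IsUniform (V i) Set.univ P volume),
        P.real {ω | t ≤ |g (OnlineNN.nnTree fun i => V i ω) -
            ∫ ω', g (OnlineNN.nnTree fun i => V i ω') ∂P|} ≤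
          2 * Real.exp (-(t ^ 2 / (64 * n * L ^ 2 * φ ^ 2))) +
            Real.exp (-(φ * Real.log φ / 10)) := by
  obtain ⟨K, hK⟩ := OnlineNN.exists_isNearestBound d
  refine ⟨1 + 2 * K, by positivity, ?_⟩
  intro n _ α _ L hL g hg hgB φ hφ hCφ t ht Ω _ P _ V hV hind hunif
  -- The increments are bounded surely, so there is no exceptional event and the Gaussian term alone
  -- suffices.
  refine le_trans ?_ (le_add_of_nonneg_right (Real.exp_pos _).le)
  -- Here `log n = 0` gives no lower bound on `φ`, but there is only one tree and the deviation is
  -- zero.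
  by_cases hn : n = 1
  · subst hn
    have : ∀ x : Fin 1 → OnlineNN.Torus d 1, g (OnlineNN.nnTree x) =
        g (OnlineNN.nnTree fun _ => (0 : OnlineNN.Torus d 1)) := fun x =>
      congrArg g (Subsingleton.elim _ _)
    simp only [this, integral_const, probReal_univ, one_smul, sub_self, abs_zero]
    rcases ht.eq_or_lt with rfl | ht
    · refine measureReal_le_one.trans ?_
      norm_num
    · simp only [ht.not_ge, Set.ofPred_false, measureReal_empty]
      positivity
  have hn2 : (2 : ℝ) ≤ n := by
    have := NeZero.ne n
    exact_mod_cast (show 2 ≤ n by omega)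
  set μ : Measure (OnlineNN.Torus d n) := cond volume Set.univ
  have hmap : ∀ i, P.map (V i) = μ := hunif
  have : IsProbabilityMeasure μ := by
    rw [← hmap 0]
    exact Measure.isProbabilityMeasure_map (hV 0).aemeasurable
  have hjoint : P.map (fun ω i => V i ω) = Measure.pi fun _ => μ := by
    rw [(iIndepFun_iff_map_fun_eq_pi_map fun i => (hV i).aemeasurable).mp hind]
    simp only [hmap]
  have hVm : Measurable fun ω i => V i ω := measurable_pi_lambda _ hV
  have hf : Measurable fun x : Fin n → OnlineNN.Torus d n => g (OnlineNN.nnTree x) :=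
    OnlineNN.measurable_comp_nnTree g
  have hB : ∀ T, |g T| ≤ (n : ℝ) ^ α := fun T => by
    rw [abs_of_nonneg (hgB T).1]
    exact (hgB T).2
  have hconc := measureReal_abs_sub_integral_ge_le μ hf (fun x => hB _)
    (OnlineNN.abs_integral_splice_sub_le hK μ (OnlineNN.uniform_torus_singleton hd) hL.le hg hB) ht
  rw [← hjoint, integral_map hVm.aemeasurable hf.aestronglyMeasurable,
    map_measureReal_apply hVm (measurableSet_le measurable_const (hf.sub_const _).abs)] at hconc
  refine hconc.trans (mul_le_mul_of_nonneg_left (Real.exp_le_exp.mpr ?_) zero_le_two)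
  have hlog : 1 / 2 ≤ Real.log n := by
    have h1 := Real.log_le_log two_pos hn2
    have h2 := Real.log_two_gt_d9
    linarith
  have hK0 : (0 : ℝ) ≤ K := Nat.cast_nonneg K
  -- Uses `1 ≤ 2 * log n` to absorb the constants into `φ ≥ (1 + 2 * K) * log n`. The increments are
  -- then at most `8 * L * φ`, which yields 32 in the denominator, better than the required 64.
  have hc : 2 * (1 + 2 * K * (1 + Real.log n)) ≤ 8 * φ := by nlinarith
  have hc0 : 0 < 2 * (1 + 2 * K * (1 + Real.log n)) := by
    have : 0 ≤ Real.log n := by linarith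
    positivity
  rw [neg_div, neg_le_neg_iff]
  refine div_le_div_of_nonneg_left (sq_nonneg t) (by positivity) ?_
  have hsq := pow_le_pow_left₀ hc0.le hc 2
  have hnL : 0 ≤ (n : ℝ) * L ^ 2 := by positivity
  nlinarith [mul_le_mul_of_nonneg_left hsq hnL, mul_nonneg hnL (sq_nonneg φ)]
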